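/- Let $X$ be a complex Banach space, let $1\le k\le 6$, and let $A$ be a (possibly unbounded) linear operator on $X$ with domain $D(A)$. Let $\delta(\zeta)=\sum_{j=0}^k\delta_j\zeta^j=\sum_{\ell=1}^k\frac1\ell(1-\zeta)^\ell$ be the generating polynomial of the $k$-step backward difference formula (BDF), and let $\alpha\in(0,\pi/2]$ be its angle of A($\alpha$)-stability, i.e. the largest angle such that for every $\mu\ne0$ with $|\arg(-\mu)|<\alpha$ all solutions of $\sum_{j=0}^k\delta_jy_{n-j}=\mu y_n$, $n\ge k$, with arbitrary starting values, remain bounded. Suppose that for some angle $\vartheta>\pi-\alpha$ the resolvent $(\lambda-A)^{-1}$ exists and $A(\lambda-A)^{-1}$ is uniformly bounded for $\lambda$ in the sector $\Sigma_\vartheta=\{z\in\mathbb C\setminus\{0\}:|\arg z|<\vartheta\}$. Then there is a constant $C$ such that for every stepsize $\tau>0$, every $N\ge2$, every $1\le p\le\infty$ and all $f_1,\dots,f_N\in X$, the numerical solution $u_n\in D(A)$ of $$\frac1\tau\sum_{j=0}^k\delta_ju_{n-j}=Au_n+f_n,\quad k\le n\le N,\qquad u_0=\dots=u_{k-1}=0,$$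 satisfies $$\|(Au_n)_{n=1}^N\|_{\ell^p(X)}\le C\,\log N\,\|(f_n)_{n=1}^N\|_{\ell^p(X)}.$$ The constant $C$ is independent of $N$, $\tau$ and $p$. -/

import Mathlib

namespace BDF

/-- The open sector `Σ_ϑ = {z ∈ ℂ \ {0} : |arg z| < ϑ}`. -/
def sector (ϑ : ℝ) : Set ℂ := {z | z ≠ 0 ∧ |z.arg| < ϑ}

/-- The generating polynomial `δ(ζ) = ∑_{ℓ=1}^k (1/ℓ) (1 - ζ)^ℓ` of the `k`-step backward
difference formula; its coefficients `δ_0, …, δ_k` are the coefficients of the method. -/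
noncomputable def genPoly (k : ℕ) : Polynomial ℂ :=
  ∑ l ∈ Finset.Icc 1 k, Polynomial.C (1 / (l : ℂ)) * (1 - Polynomial.X) ^ l

/-- The backward difference `∑_{j=0}^k δ_j u_{n-j}` (not yet divided by the stepsize).
It is only used for `n ≥ k`, so that the subtraction `n - j` is the true one. -/
noncomputable def diffSum {E : Type*} [AddCommGroup E] [Module ℂ E]
    (k : ℕ) (u : ℕ → E) (n : ℕ) : E :=
  ∑ j ∈ Finset.range (k + 1), (genPoly k).coeff j • u (n - j)

/-- The stability region of the `k`-step BDF method: the set of all `μ = τ λ` such that, for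
arbitrary starting values, every numerical solution of the scalar equation `y' = λ y`
with stepsize `τ` remains bounded. -/
def stabilityRegion (k : ℕ) : Set ℂ :=
  {μ | ∀ y : ℕ → ℂ, (∀ n, k ≤ n → diffSum k y n = μ * y n) → ∃ B : ℝ, ∀ n, ‖y n‖ ≤ B}

/-- `A(α)`-stability of the `k`-step BDF method: the stability region contains the sector
`|arg (-μ)| < α`, `μ ≠ 0`, around the negative real axis. -/
def IsAAlphaStable (k : ℕ) (α : ℝ) : Prop :=
  {μ : ℂ | -μ ∈ sector α} ⊆ stabilityRegion k

/-- The angle of `A(α)`-stability of the `k`-step BDF method: the largest angle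
`α ∈ (0, π/2]` for which the method is `A(α)`-stable. -/
noncomputable def stabilityAngle (k : ℕ) : ℝ :=
  sSup {α : ℝ | 0 < α ∧ α ≤ Real.pi / 2 ∧ IsAAlphaStable k α}

variable {X : Type*} [NormedAddCommGroup X] [NormedSpace ℂ X]

/-- A (necessarily unique) resolvent operator `R = (z - A)⁻¹` of an unbounded operator `A`:
a bounded operator on `X` with range in the domain of `A` that is a two-sided inverse
of `z - A`. -/
structure Resolvent (A : X →ₗ.[ℂ] X) (z : ℂ) where
  toCLM : X →L[ℂ] X
  mem_domain : ∀ y : X, toCLM y ∈ A.domain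
  right_inv : ∀ y : X, z • toCLM y - A ⟨toCLM y, mem_domain y⟩ = y
  left_inv : ∀ x : A.domain, toCLM (z • (x : X) - A x) = x

/-- `A (z - A)⁻¹` exists and is uniformly bounded for `z` in the sector `Σ_ϑ`. -/
def BoundedOnSector (A : X →ₗ.[ℂ] X) (ϑ : ℝ) : Prop :=
  ∃ M : ℝ, ∀ z ∈ sector ϑ, ∃ R : Resolvent A z,
    ∀ y : X, ‖A ⟨R.toCLM y, R.mem_domain y⟩‖ ≤ M * ‖y‖

/-- `u_0, …, u_N` is the numerical solution of `u' = A u + f` by the `k`-step BDF method with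
stepsize `τ` and zero starting values `u_0 = … = u_{k-1} = 0`. -/
def IsNumericalSolution (A : X →ₗ.[ℂ] X) (k : ℕ) (τ : ℝ) (N : ℕ)
    (f : ℕ → X) (u : ℕ → A.domain) : Prop :=
  (∀ n, n < k → u n = 0) ∧
  ∀ n, k ≤ n → n ≤ N →
    (1 / (τ : ℂ)) • diffSum k (fun m => (u m : X)) n = A (u n) + f n

/-- The norm `‖(v_n)_{n=1}^N‖_{ℓ^p(X)}`, for `1 ≤ p ≤ ∞`. -/
noncomputable def seqNorm (p : ENNReal) (N : ℕ) (v : ℕ → X) : ℝ :=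
  ‖(WithLp.toLp p (fun i : Fin N => v (i + 1)) : PiLp p (fun _ : Fin N => X))‖

end BDF

namespace BDF

open Metric

/-! ### Cauchy estimates and decay of Taylor coefficients. -/

section Cauchy

variable {F : Type*} [NormedAddCommGroup F] [NormedSpace ℂ F] [CompleteSpace F]

/-! With generating functions the scheme reads `(δ(ζ) - τA) u(ζ) = τ f(ζ)`. Hence `A u_n` is the
convolution of `f` with the Taylor coefficients `E_n` of `K(ζ) = δ(ζ) (δ(ζ) - τA)⁻¹ - 1`
(`IsNumericalSolution.apply_eq_convolution`). By Young's inequality it suffices that the norms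
`‖E_n‖`, `n < N`, sum to `O(log N)`, uniformly in `τ`; this follows from `‖E_n‖ = O(1/n)`.

For `|ζ| < 1` and `ζ ≠ 0` the unbounded sequence `ζ⁻ⁿ` solves the scalar recurrence with `μ = δ(ζ)`.
So `δ(ζ)` avoids the stability region and `δ(ζ)/τ` lies in the sector of the resolvent bound
(`genPoly_eval_mem_sector`). This bounds `K` independently of `τ`. Since `1` is the only zero of `δ`
in the closed disc, and a simple one, `|δ(ζ)| ≥ c|1 - ζ|`, and the resolvent identity gives
`‖K''(ζ)‖ = O(|1 - ζ|⁻²)` (`norm_second_deriv_aux`). On the circle of radius `r = 1 - 1/(n+2)` the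
mean of `|1 - ζ|⁻²` is `1/(1 - r²) ≤ n + 2`, and Cauchy's formula for `K''` gives the decay
(`norm_taylorCoeff_add_two_le`). -/

theorem continuousOn_inv_norm_one_sub_sq {r : ℝ} (h1 : r < 1) :
    ContinuousOn (fun z : ℂ => (‖1 - z‖ ^ 2)⁻¹) (sphere 0 r) := by
  apply ContinuousOn.inv₀ (by fun_prop)
  intro z hz h
  rw [mem_sphere_zero_iff_norm] at hz
  have : (1 : ℂ) = z := by simpa [sub_eq_zero] using h
  rw [← this, norm_one] at hz
  exact h1.ne hz.symm

/-- Mean square of `1 / |1 - z|` over a circle inside the unit disc, from the Poisson formula. -/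
theorem circleAverage_inv_norm_one_sub_sq {r : ℝ} (h0 : 0 < r) (h1 : r < 1) :
    Real.circleAverage (fun z : ℂ => (‖1 - z‖ ^ 2)⁻¹) 0 r = (1 - r ^ 2)⁻¹ := by
  -- The point `r²` is the reflection of `1` in the circle: `z - r² = z(1 - z̄)` there, so the
  -- Poisson kernel at `r²` equals `(1 - r²)/|1 - z|²`.
  have hw : ((r ^ 2 : ℝ) : ℂ) ∈ ball (0 : ℂ) r := by
    rw [mem_ball_zero_iff, Complex.norm_real, Real.norm_of_nonneg (by positivity)]
    nlinarith
  have hP := (diffContOnCl_const (𝕜 := ℂ) (c := (1 : ℂ))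
    (s := ball (0 : ℂ) r)).circleAverage_poissonKernel_smul' hw
  have hpos : 0 < 1 - r ^ 2 := by nlinarith
  have hc : Real.circleAverage (fun z : ℂ => (1 - r ^ 2) • ((‖1 - z‖ ^ 2)⁻¹ : ℝ)) 0 r = 1 := by
    have hre := Complex.ofRealCLM.circleAverage_comp_comm
      (f := fun z : ℂ => (1 - r ^ 2) • ((‖1 - z‖ ^ 2)⁻¹ : ℝ)) (c := 0) (R := r) ?_
    · apply Complex.ofReal_injective
      rw [Complex.ofRealCLM_apply] at hre
      rw [← hre, Complex.ofReal_one]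
      refine Eq.trans ?_ hP
      apply Real.circleAverage_congr_sphere
      intro z hz
      rw [abs_of_pos h0, mem_sphere_zero_iff_norm] at hz
      have hn : ‖z - ((r ^ 2 : ℝ) : ℂ)‖ ^ 2 = r ^ 2 * ‖1 - z‖ ^ 2 := by
        have e : z.re * z.re + z.im * z.im = r ^ 2 := by
          rw [← Complex.normSq_apply, Complex.normSq_eq_norm_sq, hz]
        rw [← Complex.normSq_eq_norm_sq, ← Complex.normSq_eq_norm_sq, Complex.normSq_apply,
          Complex.normSq_apply, Complex.sub_re, Complex.sub_im, Complex.sub_re, Complex.sub_im,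
          Complex.ofReal_re, Complex.ofReal_im, Complex.one_re, Complex.one_im]
        linear_combination (1 - r ^ 2) * e
      simp only [Function.comp_apply, sub_zero, hn, hz, Complex.norm_real, norm_pow,
        Real.norm_eq_abs, sq_abs, Complex.ofRealCLM_apply, smul_eq_mul, mul_one, Complex.real_smul]
      congr 1
      field_simp
    · apply ContinuousOn.circleIntegrable h0.le
      exact continuousOn_const.mul (continuousOn_inv_norm_one_sub_sq h1)
  rw [Real.circleAverage_fun_smul, smul_eq_mul] at hc
  exact eq_inv_of_mul_eq_one_right hc

/-- The Cauchy estimate with the mean value of the norm over the circle. -/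
theorem norm_iteratedDeriv_le_circleAverage {f : ℂ → F} {r : ℝ} (h0 : 0 < r)
    (hf : DifferentiableOn ℂ f (closedBall 0 r)) (n : ℕ) :
    ‖iteratedDeriv n f 0‖ ≤ n.factorial * (Real.circleAverage (fun z => ‖f z‖) 0 r * (r ^ n)⁻¹) := by
  have h := hf.circleIntegral_one_div_sub_center_pow_smul h0 n
  have hb : ‖∮ z in C(0, r), (1 / (z - 0) ^ (n + 1)) • f z‖
      ≤ ∫ θ in (0 : ℝ)..2 * Real.pi, (r ^ n)⁻¹ * ‖f (circleMap 0 r θ)‖ := by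
    rw [circleIntegral]
    refine (intervalIntegral.norm_integral_le_integral_norm Real.two_pi_pos.le).trans_eq ?_
    congr 1
    ext θ
    rw [norm_smul, norm_smul, deriv_circleMap, sub_zero, norm_mul, norm_div, norm_pow,
      norm_circleMap_zero, Complex.norm_I, norm_one, abs_of_pos h0, pow_succ]
    field_simp
  rw [h, norm_smul, norm_div, intervalIntegral.integral_const_mul] at hb
  rw [Real.circleAverage, smul_eq_mul]
  have hn : ‖(2 * Real.pi * Complex.I : ℂ)‖ = 2 * Real.pi := by
    simp [Real.pi_pos.le]
  rw [hn, Complex.norm_natCast, div_mul_eq_mul_div, div_le_iff₀ (by positivity)] at hb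
  have : ‖iteratedDeriv n f 0‖ ≤ (2 * Real.pi)⁻¹ *
      ((r ^ n)⁻¹ * (∫ θ in (0 : ℝ)..2 * Real.pi, ‖f (circleMap 0 r θ)‖) * n.factorial) := by
    rw [le_inv_mul_iff₀ Real.two_pi_pos]
    exact hb
  refine this.trans_eq (by ring)

/-- The factor `r⁻ⁿ` in Cauchy's estimate stays bounded at `r = 1 - 1/(n+2)`: here `r⁻¹ = 1 +
1/(n+1)`, whose `n`-th power is at most `e`. -/
theorem inv_one_sub_inv_pow_le (n : ℕ) : ((1 - 1 / ((n : ℝ) + 2)) ^ n)⁻¹ ≤ 3 := by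
  have hn : (0 : ℝ) < n + 1 := by positivity
  have e : (1 - 1 / ((n : ℝ) + 2))⁻¹ = 1 / ((n : ℝ) + 1) + 1 := by
    have : 1 - 1 / ((n : ℝ) + 2) = (n + 1) / (n + 2) := by field_simp; ring
    rw [this, inv_div]
    field_simp
    ring
  rw [← inv_pow, e]
  calc (1 / ((n : ℝ) + 1) + 1) ^ n ≤ Real.exp (1 / ((n : ℝ) + 1)) ^ n := by
        gcongr; exact Real.add_one_le_exp _
    _ = Real.exp (n * (1 / ((n : ℝ) + 1))) := by rw [← Real.exp_nat_mul]
    _ ≤ Real.exp 1 := by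
        gcongr
        rw [mul_one_div, div_le_one hn]; linarith
    _ ≤ 3 := by linarith [Real.exp_one_lt_d9]

/-- Taylor coefficients of a bounded function on the unit disc. -/
theorem norm_taylorCoeff_le {f : ℂ → F} (hf : DifferentiableOn ℂ f (ball 0 1)) {M : ℝ}
    (hM : ∀ z ∈ ball (0 : ℂ) 1, ‖f z‖ ≤ M) (n : ℕ) :
    ‖((n.factorial : ℂ)⁻¹ • iteratedDeriv n f 0)‖ ≤ 3 * M := by
  set r : ℝ := 1 - 1 / ((n : ℝ) + 2) with hr
  have h1 : r < 1 := by rw [hr]; linarith [show (0:ℝ) < 1 / ((n : ℝ) + 2) by positivity]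
  have h0 : 0 < r := by
    rw [hr, sub_pos, div_lt_one (by positivity)]
    linarith [(Nat.cast_nonneg n : (0:ℝ) ≤ n)]
  have hsub : closedBall (0 : ℂ) r ⊆ ball 0 1 := closedBall_subset_ball h1
  have hM0 : 0 ≤ M := (norm_nonneg _).trans (hM 0 (by simp))
  have h := norm_iteratedDeriv_le_circleAverage h0 (hf.mono hsub) n
  have hav : Real.circleAverage (fun z => ‖f z‖) 0 r ≤ M := by
    apply Real.circleAverage_mono_on_of_le_circle
    · exact ContinuousOn.circleIntegrable h0.le
        ((hf.continuousOn.mono (sphere_subset_closedBall.trans hsub)).norm)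
    · intro z hz
      rw [abs_of_pos h0] at hz
      exact hM z (hsub (sphere_subset_closedBall hz))
  rw [norm_smul, norm_inv, Complex.norm_natCast, inv_mul_le_iff₀ (by positivity)]
  refine h.trans (mul_le_mul_of_nonneg_left ?_ (by positivity))
  rw [mul_comm 3 M]
  exact mul_le_mul hav (inv_one_sub_inv_pow_le n) (by positivity) hM0

/-- Decay of Taylor coefficients when the second derivative is `O(|1 - z|⁻²)`. -/
theorem norm_taylorCoeff_add_two_le {f : ℂ → F} (hf : DifferentiableOn ℂ f (ball 0 1)) {B : ℝ}
    (hB : ∀ z ∈ ball (0 : ℂ) 1, ‖deriv (deriv f) z‖ ≤ B * (‖1 - z‖ ^ 2)⁻¹) (n : ℕ) :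
    (n + 1) * ‖(((n + 2).factorial : ℂ)⁻¹ • iteratedDeriv (n + 2) f 0)‖ ≤ 3 * B := by
  set r : ℝ := 1 - 1 / ((n : ℝ) + 2) with hr
  have h1 : r < 1 := by rw [hr]; linarith [show (0:ℝ) < 1 / ((n : ℝ) + 2) by positivity]
  have h0 : 0 < r := by
    rw [hr, sub_pos, div_lt_one (by positivity)]
    linarith [(Nat.cast_nonneg n : (0:ℝ) ≤ n)]
  have hsub : closedBall (0 : ℂ) r ⊆ ball 0 1 := closedBall_subset_ball h1
  have hB0 : 0 ≤ B := by simpa using (norm_nonneg _).trans (hB 0 (by simp))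
  have hd : DifferentiableOn ℂ (deriv (deriv f)) (ball 0 1) :=
    (hf.deriv isOpen_ball).deriv isOpen_ball
  have h := norm_iteratedDeriv_le_circleAverage h0 (hd.mono hsub) n
  have hav : Real.circleAverage (fun z => ‖deriv (deriv f) z‖) 0 r ≤ B * ((n : ℝ) + 2) := by
    have hi : CircleIntegrable (fun z : ℂ => B * (‖1 - z‖ ^ 2)⁻¹) 0 r := by
      apply ContinuousOn.circleIntegrable h0.le
      exact continuousOn_const.mul (continuousOn_inv_norm_one_sub_sq h1)
    have hm : Real.circleAverage (fun z => ‖deriv (deriv f) z‖) 0 r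
        ≤ Real.circleAverage (fun z : ℂ => B • (‖1 - z‖ ^ 2)⁻¹) 0 r := by
      refine Real.circleAverage_mono ?_ hi ?_
      · exact ContinuousOn.circleIntegrable h0.le
          ((hd.continuousOn.mono (sphere_subset_closedBall.trans hsub)).norm)
      · intro z hz
        rw [abs_of_pos h0] at hz
        exact hB z (hsub (sphere_subset_closedBall hz))
    rw [Real.circleAverage_fun_smul, circleAverage_inv_norm_one_sub_sq h0 h1, smul_eq_mul] at hm
    refine hm.trans ?_
    gcongr
    have e : 1 / ((n : ℝ) + 2) ≤ 1 - r ^ 2 := by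
      have : 1 / ((n : ℝ) + 2) = 1 - r := by rw [hr]; ring
      rw [this]; nlinarith
    calc (1 - r ^ 2)⁻¹ ≤ (1 / ((n : ℝ) + 2))⁻¹ := by gcongr
      _ = (n : ℝ) + 2 := by simp
  have hit : iteratedDeriv (n + 2) f 0 = iteratedDeriv n (deriv (deriv f)) 0 := by
    rw [iteratedDeriv_succ', iteratedDeriv_succ']
  rw [norm_smul, norm_inv, Complex.norm_natCast, hit, mul_left_comm,
    inv_mul_le_iff₀ (by positivity)]
  have hfac : ((n + 2).factorial : ℝ) = (n + 2) * ((n + 1) * n.factorial) := by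
    push_cast [Nat.factorial_succ]; ring
  rw [hfac]
  calc ((n : ℝ) + 1) * ‖iteratedDeriv n (deriv (deriv f)) 0‖
      ≤ (n + 1) * (n.factorial * ((B * ((n : ℝ) + 2)) * 3)) := by
        refine mul_le_mul_of_nonneg_left (h.trans ?_) (by positivity)
        gcongr
        exact inv_one_sub_inv_pow_le n
    _ = _ := by ring

end Cauchy

/-! ### Zeros and range of the BDF generating polynomial on the unit disc. -/

section GeneratingPolynomial

/-- `δ(ζ) = (1 - ζ) q(ζ)`. -/
theorem genPoly_eval_eq (k : ℕ) (z : ℂ) :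
    (genPoly k).eval z = (1 - z) * ∑ l ∈ Finset.Icc 1 k, 1 / (l : ℂ) * (1 - z) ^ (l - 1) := by
  rw [genPoly, Polynomial.eval_finsetSum, Finset.mul_sum]
  refine Finset.sum_congr rfl fun l hl => ?_
  obtain ⟨m, rfl⟩ := Nat.exists_eq_add_of_le' (Finset.mem_Icc.1 hl).1
  simp only [Polynomial.eval_mul, Polynomial.eval_C, Polynomial.eval_pow, Polynomial.eval_sub,
    Polynomial.eval_one, Polynomial.eval_X, Nat.add_sub_cancel]
  ring

/-- A polynomial with dominant constant coefficient has no zeros in the closed unit disc. -/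
theorem eval_ne_zero_of_dominant {z : ℂ} (hz : ‖z‖ ≤ 1) (n : ℕ) (a : ℝ) (c : ℕ → ℝ)
    (h : ∑ j ∈ Finset.range n, |c j| < a) :
    (a : ℂ) + ∑ j ∈ Finset.range n, (c j : ℂ) * z ^ (j + 1) ≠ 0 := by
  intro h0
  have ha : 0 ≤ a := (Finset.sum_nonneg fun j _ => abs_nonneg (c j)).trans h.le
  have e : (a : ℂ) = -∑ j ∈ Finset.range n, (c j : ℂ) * z ^ (j + 1) := eq_neg_of_add_eq_zero_left h0
  have hn : a ≤ ∑ j ∈ Finset.range n, |c j| := by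
    calc a = ‖(a : ℂ)‖ := by rw [Complex.norm_real, Real.norm_of_nonneg ha]
      _ ≤ ∑ j ∈ Finset.range n, |c j| := by
        rw [e, norm_neg]
        refine norm_sum_le_of_le _ fun j _ => ?_
        rw [norm_mul, norm_pow, Complex.norm_real, Real.norm_eq_abs]
        exact mul_le_of_le_one_right (abs_nonneg _) (pow_le_one₀ (norm_nonneg _) hz)
  linarith

/-- Strong zero-stability of the BDF methods of order at most six. The polynomial multiplied by
a truncation of its inverse has a dominant constant coefficient. -/
theorem genPoly_quotient_ne_zero {k : ℕ} (hk1 : 1 ≤ k) (hk6 : k ≤ 6) {z : ℂ} (hz : ‖z‖ ≤ 1) :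
    ∑ l ∈ Finset.Icc 1 k, 1 / (l : ℂ) * (1 - z) ^ (l - 1) ≠ 0 := by
  suffices ∃ (m : ℂ) (n : ℕ) (a : ℝ) (c : ℕ → ℝ), ∑ j ∈ Finset.range n, |c j| < a ∧
      (∑ l ∈ Finset.Icc 1 k, 1 / (l : ℂ) * (1 - z) ^ (l - 1)) * m =
        a + ∑ j ∈ Finset.range n, (c j : ℂ) * z ^ (j + 1) by
    obtain ⟨m, n, a, c, h, e⟩ := this
    intro h0
    rw [h0, zero_mul] at e
    exact eval_ne_zero_of_dominant hz n a c h e.symm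
  interval_cases k
  · exact ⟨1, 0, 1, 0, by simp, by simp⟩
  · refine ⟨2, 1, 3, fun j => ([-1] : List ℝ).getD j 0, ?_, ?_⟩
    · norm_num [Finset.sum_range_succ]
    · norm_num [Finset.sum_range_succ, Finset.sum_Icc_succ_top]
      ring
  · refine ⟨6, 2, 11, fun j => ([-7, 2] : List ℝ).getD j 0, ?_, ?_⟩
    · norm_num [Finset.sum_range_succ]
    · norm_num [Finset.sum_range_succ, Finset.sum_Icc_succ_top]
      ring
  -- From here on the constant term of the quotient no longer dominates by itself (`25 - 23z + 13z²
  -- - 3z³` after clearing denominators), so a nontrivial multiplier is needed.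
  · refine ⟨12 * (7 + 6 * z), 4, 175, fun j => ([-11, -47, 57, -18] : List ℝ).getD j 0, ?_, ?_⟩
    · norm_num [Finset.sum_range_succ]
    · norm_num [Finset.sum_range_succ, Finset.sum_Icc_succ_top]
      ring
  · refine ⟨60 * (2 + 2 * z + z ^ 2), 6, 274,
      fun j => ([-52, 85, -15, 35, -39, 12] : List ℝ).getD j 0, ?_, ?_⟩
    · norm_num [Finset.sum_range_succ]
    · norm_num [Finset.sum_range_succ, Finset.sum_Icc_succ_top]
      ring
  · refine ⟨60 * (5 + 7 * z + 2 * z ^ 2 - 3 * z ^ 3 - 2 * z ^ 4), 9, 735,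
      fun j => ([-36, -12, -23, -12, -227, 69, 120, -94, 20] : List ℝ).getD j 0, ?_, ?_⟩
    · norm_num [Finset.sum_range_succ]
    · norm_num [Finset.sum_range_succ, Finset.sum_Icc_succ_top]
      ring

/-- The quotient `δ(z)/(1 - z)` has no zero on the compact closed disc, so its modulus has a
positive minimum. -/
theorem exists_le_norm_genPoly_eval {k : ℕ} (hk1 : 1 ≤ k) (hk6 : k ≤ 6) :
    ∃ c : ℝ, 0 < c ∧ ∀ z : ℂ, ‖z‖ ≤ 1 → c * ‖1 - z‖ ≤ ‖(genPoly k).eval z‖ := by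
  have hcont : ContinuousOn
      (fun z : ℂ => ‖∑ l ∈ Finset.Icc 1 k, 1 / (l : ℂ) * (1 - z) ^ (l - 1)‖) (closedBall 0 1) := by
    fun_prop
  obtain ⟨w, hw, hmin⟩ := (isCompact_closedBall (0 : ℂ) 1).exists_isMinOn ⟨0, by simp⟩ hcont
  refine ⟨_, norm_pos_iff.2 (genPoly_quotient_ne_zero hk1 hk6 (by simpa using hw)), fun z hz => ?_⟩
  rw [genPoly_eval_eq, norm_mul, mul_comm]
  exact mul_le_mul_of_nonneg_left (hmin (by simpa using hz)) (norm_nonneg _)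

theorem genPoly_eval_ne_zero {k : ℕ} (hk1 : 1 ≤ k) (hk6 : k ≤ 6) {z : ℂ} (hz : ‖z‖ < 1) :
    (genPoly k).eval z ≠ 0 := by
  rw [genPoly_eval_eq]
  refine mul_ne_zero (fun h => ?_) (genPoly_quotient_ne_zero hk1 hk6 hz.le)
  rw [← sub_eq_zero.1 h, norm_one] at hz
  exact lt_irrefl _ hz

theorem natDegree_genPoly_le (k : ℕ) : (genPoly k).natDegree ≤ k := by
  refine Polynomial.natDegree_sum_le_of_forall_le _ _ fun l hl => ?_
  refine (Polynomial.natDegree_C_mul_le _ _).trans ?_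
  refine Polynomial.natDegree_pow_le.trans ?_
  have h1 : (1 - Polynomial.X : Polynomial ℂ).natDegree ≤ 1 :=
    (Polynomial.natDegree_sub_le _ _).trans (by simp)
  calc l * _ ≤ l * 1 := Nat.mul_le_mul_left _ h1
    _ ≤ k := by simpa using (Finset.mem_Icc.1 hl).2

theorem genPoly_eval_eq_sum (k : ℕ) (z : ℂ) :
    (genPoly k).eval z = ∑ j ∈ Finset.range (k + 1), (genPoly k).coeff j * z ^ j :=
  Polynomial.eval_eq_sum_range' (Nat.lt_succ_of_le (natDegree_genPoly_le k)) z

theorem abs_arg_neg_add_abs_arg {z : ℂ} (hz : z ≠ 0) : |(-z).arg| + |z.arg| = Real.pi := by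
  rcases lt_trichotomy z.im 0 with h | h | h
  · rw [Complex.arg_neg_eq_arg_add_pi_of_im_neg h, abs_of_neg (Complex.arg_neg_iff.2 h),
      abs_of_nonneg (by linarith [Complex.neg_pi_lt_arg z])]
    ring
  · obtain ⟨x, rfl⟩ : ∃ x : ℝ, z = x := ⟨z.re, Complex.ext rfl (by simpa using h)⟩
    rw [← Complex.ofReal_neg]
    have hx : x ≠ 0 := by simpa using hz
    rcases lt_or_gt_of_ne hx with h | h
    · rw [Complex.arg_ofReal_of_neg h, Complex.arg_ofReal_of_nonneg (by linarith)]
      simp [Real.pi_pos.le]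
    · rw [Complex.arg_ofReal_of_nonneg h.le, Complex.arg_ofReal_of_neg (by linarith)]
      simp [Real.pi_pos.le]
  · rw [Complex.arg_neg_eq_arg_sub_pi_of_im_pos h, abs_of_nonneg (Complex.arg_nonneg_iff.2 h.le),
      abs_of_nonpos (by linarith [Complex.arg_le_pi z])]
    ring

/-- Values of `δ` in the open unit disc avoid the stability region. -/
theorem genPoly_eval_notMem_stabilityRegion {k : ℕ} {z : ℂ} (hz : ‖z‖ < 1) (h0 : z ≠ 0) :
    (genPoly k).eval z ∉ stabilityRegion k := by
  intro h
  -- The sequence `z⁻ⁿ` solves the recurrence with `μ = δ(z)` and grows geometrically.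
  obtain ⟨B, hB⟩ := h (fun n => (z ^ n)⁻¹) fun n hn => by
    rw [diffSum, genPoly_eval_eq_sum, Finset.sum_mul]
    refine Finset.sum_congr rfl fun j hj => ?_
    obtain ⟨m, rfl⟩ := Nat.exists_eq_add_of_le ((Finset.mem_range_succ_iff.1 hj).trans hn)
    rw [Nat.add_sub_cancel_left, smul_eq_mul, pow_add]
    field_simp
  have h1 : 1 < ‖z‖⁻¹ := (one_lt_inv₀ (norm_pos_iff.2 h0)).2 hz
  obtain ⟨n, hn⟩ := pow_unbounded_of_one_lt B h1
  have := hB n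
  rw [norm_inv, norm_pow, ← inv_pow] at this
  linarith

theorem genPoly_eval_zero (k : ℕ) :
    (genPoly k).eval 0 = ((∑ l ∈ Finset.Icc 1 k, 1 / (l : ℝ) : ℝ) : ℂ) := by
  simp [genPoly, Polynomial.eval_finsetSum]

/-- Any admissible `α > π - ϑ` will do, so the supremum need not be attained. Avoiding the stability
region forces `|arg(-δ(z))| ≥ α`, that is, `|arg δ(z)| ≤ π - α < ϑ`. -/
theorem genPoly_eval_mem_sector {k : ℕ} (hk1 : 1 ≤ k) (hk6 : k ≤ 6) {ϑ : ℝ}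
    (hϑ : Real.pi - stabilityAngle k < ϑ) {z : ℂ} (hz : ‖z‖ < 1) :
    (genPoly k).eval z ∈ sector ϑ := by
  have hne := genPoly_eval_ne_zero hk1 hk6 hz
  refine ⟨hne, ?_⟩
  -- Were there no admissible angle, `sSup ∅ = 0` would give `ϑ > π`, and the sector would be the
  -- whole punctured plane.
  rcases Set.eq_empty_or_nonempty
    {α : ℝ | 0 < α ∧ α ≤ Real.pi / 2 ∧ IsAAlphaStable k α} with hS | hS
  · rw [stabilityAngle, hS, Real.sSup_empty, sub_zero] at hϑ
    exact (Complex.abs_arg_le_pi _).trans_lt hϑ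
  · obtain ⟨α, ⟨hα0, hα2, hα⟩, hlt⟩ := exists_lt_of_lt_csSup hS
      (show Real.pi - ϑ < stabilityAngle k by linarith)
    have hge : α ≤ |(-(genPoly k).eval z).arg| := by
      by_contra! hcon
      -- At `z = 0` the solution `z⁻ⁿ` is unavailable, but `δ(0)` is a positive real number, so
      -- `|arg(-δ(0))| = π`.
      rcases eq_or_ne z 0 with rfl | h0
      · have hnn : 0 ≤ ∑ l ∈ Finset.Icc 1 k, 1 / (l : ℝ) :=
          Finset.sum_nonneg fun l _ => by positivity
        have h := abs_arg_neg_add_abs_arg hne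
        rw [genPoly_eval_zero, Complex.arg_ofReal_of_nonneg hnn, abs_zero, add_zero,
          ← genPoly_eval_zero] at h
        linarith [Real.pi_pos]
      · exact genPoly_eval_notMem_stabilityRegion hz h0 (hα ⟨neg_ne_zero.2 hne, hcon⟩)
    linarith [abs_arg_neg_add_abs_arg hne]

theorem sector_smul {ϑ : ℝ} {z : ℂ} (hz : z ∈ sector ϑ) {t : ℝ} (ht : 0 < t) :
    (t : ℂ) * z ∈ sector ϑ :=
  ⟨mul_ne_zero (by exact_mod_cast ht.ne') hz.1, by rw [Complex.arg_real_mul _ ht]; exact hz.2⟩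

/-- A polynomial is bounded on the unit disc. -/
theorem exists_norm_eval_le (p : Polynomial ℂ) :
    ∃ D : ℝ, 0 ≤ D ∧ ∀ z : ℂ, ‖z‖ ≤ 1 → ‖p.eval z‖ ≤ D := by
  obtain ⟨D, hD⟩ := (isCompact_closedBall (0 : ℂ) 1).exists_bound_of_continuousOn
    (f := fun z => p.eval z) p.continuous.continuousOn
  exact ⟨D, (norm_nonneg _).trans (hD 0 (by simp)), fun z hz => hD z (by simpa using hz)⟩

end GeneratingPolynomial

/-! ### Derivative bounds for the kernel and its logarithmic coefficient sum. -/

section Kernel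

open Filter Topology in
/-- A solution of the resolvent identity along `p` is holomorphic. -/
theorem hasDerivAt_of_resolvent_identity {𝔸 : Type*} [NormedRing 𝔸] [NormedAlgebra ℂ 𝔸]
    (p : Polynomial ℂ) {c L : ℝ} (hc : 0 < c)
    (hp : ∀ z : ℂ, ‖z‖ ≤ 1 → c * ‖1 - z‖ ≤ ‖p.eval z‖) (T : ℂ → 𝔸)
    (hT : ∀ z ∈ ball (0 : ℂ) 1, ∀ w ∈ ball (0 : ℂ) 1,
      T z - T w = (p.eval w - p.eval z) • (T z * T w))
    (hL : ∀ z ∈ ball (0 : ℂ) 1, ‖p.eval z • T z‖ ≤ L) {z : ℂ} (hz : z ∈ ball (0 : ℂ) 1) :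
    HasDerivAt T (-(p.derivative.eval z • (T z * T z))) z := by
  have hnhds : ball (0 : ℂ) 1 ∈ 𝓝 z := isOpen_ball.mem_nhds hz
  have hne : ∀ w ∈ ball (0 : ℂ) 1, 0 < ‖1 - w‖ := by
    intro w hw
    rw [norm_pos_iff, sub_ne_zero]
    rintro rfl
    simp at hw
  have hbd : ∀ w ∈ ball (0 : ℂ) 1, ‖T w‖ ≤ L / (c * ‖1 - w‖) := by
    intro w hw
    rw [le_div_iff₀ (mul_pos hc (hne w hw))]
    have h1 := hL w hw
    rw [norm_smul, mul_comm] at h1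
    exact (mul_le_mul_of_nonneg_left (hp w (by simpa using (mem_ball_zero_iff.1 hw).le))
      (norm_nonneg _)).trans h1
  -- Continuity comes first: the a priori bound `hbd` controls `T w` near `z`, and the resolvent
  -- identity makes the difference small.
  have hcont : Tendsto T (𝓝 z) (𝓝 (T z)) := by
    rw [tendsto_iff_norm_sub_tendsto_zero]
    have hlim : Tendsto (fun w => ‖p.eval z - p.eval w‖ * (L / (c * ‖1 - w‖) * ‖T z‖)) (𝓝 z)
        (𝓝 (‖p.eval z - p.eval z‖ * (L / (c * ‖1 - z‖) * ‖T z‖))) := by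
      refine Tendsto.mul ?_ (Tendsto.mul ?_ tendsto_const_nhds)
      · exact (tendsto_const_nhds.sub p.continuous.continuousAt).norm
      · refine tendsto_const_nhds.div ?_ (mul_pos hc (hne z hz)).ne'
        exact Continuous.tendsto (f := fun w : ℂ => c * ‖1 - w‖) (by fun_prop) z
    rw [sub_self, norm_zero, zero_mul] at hlim
    refine squeeze_zero' (Eventually.of_forall fun _ => norm_nonneg _) ?_ hlim
    filter_upwards [hnhds] with w hw
    rw [hT w hw z hz, norm_smul]
    gcongr
    exact (norm_mul_le _ _).trans (mul_le_mul_of_nonneg_right (hbd w hw) (norm_nonneg _))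
  rw [hasDerivAt_iff_tendsto_slope]
  have hs : Tendsto (fun w => -(slope (fun w => p.eval w) z w • (T w * T z))) (𝓝[≠] z)
      (𝓝 (-(p.derivative.eval z • (T z * T z)))) :=
    ((hasDerivAt_iff_tendsto_slope.1 (p.hasDerivAt z)).smul
      ((hcont.mono_left nhdsWithin_le_nhds).mul tendsto_const_nhds)).neg
  refine hs.congr' ?_
  filter_upwards [nhdsWithin_le_nhds hnhds] with w hw
  rw [slope_def_module, slope_def_module, hT w hw z hz, smul_smul, ← neg_smul, smul_eq_mul]
  congr 1
  ring

/-- The expression is `(pT - 1)''` with `d, d1, d2` the values of `p, p', p''` and `s = |1 - z|`.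
Each factor `d` is absorbed into `d • t`, of norm at most `L`; at most two free factors `t` remain,
each `O(1/s)`. -/
theorem norm_second_deriv_aux {𝔸 : Type*} [NormedRing 𝔸] [NormedAlgebra ℂ 𝔸]
    (d d1 d2 : ℂ) (t : 𝔸) {s c L D : ℝ} (hc : 0 < c) (hs : 0 < s) (hs2 : s ≤ 2)
    (hd : c * s ≤ ‖d‖) (hL : ‖d • t‖ ≤ L) (h1 : ‖d1‖ ≤ D) (h2 : ‖d2‖ ≤ D) :
    ‖d2 • t - (2 * d1 ^ 2 + d * d2) • (t * t) + (2 * d * d1 ^ 2) • (t * t * t)‖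
      ≤ (2 * (D + L * D) * (L / c) + (2 * D ^ 2 + 2 * L * D ^ 2) * (L / c) ^ 2) * (s ^ 2)⁻¹ := by
  have hL0 : 0 ≤ L := (norm_nonneg _).trans hL
  have hD0 : 0 ≤ D := (norm_nonneg _).trans h1
  have hcs : ‖t‖ ≤ L / c * s⁻¹ := by
    rw [← div_eq_mul_inv, div_div, le_div_iff₀ (mul_pos hc hs)]
    rw [norm_smul, mul_comm] at hL
    exact (mul_le_mul_of_nonneg_left hd (norm_nonneg _)).trans hL
  have hsi : s⁻¹ ≤ 2 * (s ^ 2)⁻¹ := by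
    rw [← div_eq_mul_inv, le_div_iff₀ (by positivity), sq, inv_mul_cancel_left₀ hs.ne']
    exact hs2
  have ht2 : ‖t * t‖ ≤ (L / c) ^ 2 * (s ^ 2)⁻¹ := by
    refine (norm_mul_le _ _).trans ?_
    rw [← inv_pow, ← mul_pow, sq]
    exact mul_le_mul hcs hcs (norm_nonneg _) (by positivity)
  have ht1 : ‖t‖ ≤ L / c * (2 * (s ^ 2)⁻¹) :=
    hcs.trans (mul_le_mul_of_nonneg_left hsi (by positivity))
  have e : d2 • t - (2 * d1 ^ 2 + d * d2) • (t * t) + (2 * d * d1 ^ 2) • (t * t * t)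
      = d2 • t - (2 * d1 ^ 2) • (t * t) - d2 • ((d • t) * t)
        + (2 * d1 ^ 2) • ((d • t) * (t * t)) := by
    simp only [smul_mul_assoc, smul_smul, add_smul, mul_assoc]
    rw [show d * d2 = d2 * d by ring, show 2 * (d1 ^ 2 * d) = 2 * (d * d1 ^ 2) by ring]
    abel
  have hsq : ‖(2 * d1 ^ 2 : ℂ)‖ ≤ 2 * D ^ 2 := by
    rw [norm_mul, norm_pow, Complex.norm_ofNat]
    gcongr
  have hu1 : ‖(d • t) * t‖ ≤ L * (L / c * (2 * (s ^ 2)⁻¹)) :=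
    (norm_mul_le _ _).trans (mul_le_mul hL ht1 (norm_nonneg _) hL0)
  have hu2 : ‖(d • t) * (t * t)‖ ≤ L * ((L / c) ^ 2 * (s ^ 2)⁻¹) :=
    (norm_mul_le _ _).trans (mul_le_mul hL ht2 (norm_nonneg _) hL0)
  rw [e]
  calc _ ≤ ‖d2 • t‖ + ‖(2 * d1 ^ 2) • (t * t)‖ + ‖d2 • ((d • t) * t)‖
        + ‖(2 * d1 ^ 2) • ((d • t) * (t * t))‖ :=
        (norm_add_le _ _).trans (add_le_add_left ((norm_sub_le _ _).trans
          (add_le_add_left (norm_sub_le _ _) _)) _)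
    _ ≤ D * (L / c * (2 * (s ^ 2)⁻¹)) + 2 * D ^ 2 * ((L / c) ^ 2 * (s ^ 2)⁻¹)
        + D * (L * (L / c * (2 * (s ^ 2)⁻¹))) + 2 * D ^ 2 * (L * ((L / c) ^ 2 * (s ^ 2)⁻¹)) := by
        rw [norm_smul, norm_smul, norm_smul, norm_smul]
        gcongr
    _ = _ := by ring

/-- The Taylor coefficients of `p T - 1` are bounded and decay like `1 / n`, uniformly in the
solution `T` of the resolvent identity. -/
theorem exists_kernel_bound (𝔸 : Type*) [NormedRing 𝔸] [NormedAlgebra ℂ 𝔸] [CompleteSpace 𝔸]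
    (p : Polynomial ℂ) {c L : ℝ} (hc : 0 < c)
    (hp : ∀ z : ℂ, ‖z‖ ≤ 1 → c * ‖1 - z‖ ≤ ‖p.eval z‖) :
    ∃ B : ℝ, ∀ T : ℂ → 𝔸,
      (∀ z ∈ ball (0 : ℂ) 1, ∀ w ∈ ball (0 : ℂ) 1,
        T z - T w = (p.eval w - p.eval z) • (T z * T w)) →
      (∀ z ∈ ball (0 : ℂ) 1, ‖p.eval z • T z‖ ≤ L) →
      ∃ E : ℕ → 𝔸, (∀ z ∈ ball (0 : ℂ) 1, HasSum (fun n => z ^ n • E n) (p.eval z • T z - 1)) ∧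
        (∀ n, ‖E n‖ ≤ B) ∧ ∀ n : ℕ, (n + 1) * ‖E (n + 2)‖ ≤ B := by
  obtain ⟨D1, hD1, hp1⟩ := exists_norm_eval_le p.derivative
  obtain ⟨D2, hD2, hp2⟩ := exists_norm_eval_le p.derivative.derivative
  set D := max D1 D2
  set B := 2 * (D + L * D) * (L / c) + (2 * D ^ 2 + 2 * L * D ^ 2) * (L / c) ^ 2
  -- The constant is fixed before `T`, which later carries all the dependence on `τ`.
  refine ⟨max (3 * (L + ‖(1 : 𝔸)‖)) (3 * B), fun T hT hL => ?_⟩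
  have hd : ∀ z ∈ ball (0 : ℂ) 1, HasDerivAt T (-(p.derivative.eval z • (T z * T z))) z :=
    fun z hz => hasDerivAt_of_resolvent_identity p hc hp T hT hL hz
  have hK1 : ∀ z ∈ ball (0 : ℂ) 1, HasDerivAt (fun z => p.eval z • T z - 1)
      (p.derivative.eval z • T z - (p.eval z * p.derivative.eval z) • (T z * T z)) z := by
    intro z hz
    refine (((p.hasDerivAt z).smul (hd z hz)).sub_const 1).congr_deriv ?_
    rw [smul_neg, smul_smul]
    abel
  have hK2 : ∀ z ∈ ball (0 : ℂ) 1, HasDerivAt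
      (fun z => p.derivative.eval z • T z - (p.eval z * p.derivative.eval z) • (T z * T z))
      (p.derivative.derivative.eval z • T z
        - (2 * p.derivative.eval z ^ 2 + p.eval z * p.derivative.derivative.eval z) • (T z * T z)
        + (2 * p.eval z * p.derivative.eval z ^ 2) • (T z * T z * T z)) z := by
    intro z hz
    refine (((p.derivative.hasDerivAt z).smul (hd z hz)).sub
      (((p.hasDerivAt z).mul (p.derivative.hasDerivAt z)).smul
        ((hd z hz).mul (hd z hz)))).congr_deriv ?_
    simp only [Pi.mul_apply, neg_mul, mul_neg, smul_mul_assoc, mul_smul_comm, mul_assoc]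
    module
  have hdiff : DifferentiableOn ℂ (fun z => p.eval z • T z - 1) (ball 0 1) :=
    fun z hz => (hK1 z hz).differentiableAt.differentiableWithinAt
  refine ⟨fun n => (n.factorial : ℂ)⁻¹ • iteratedDeriv n (fun z => p.eval z • T z - 1) 0,
    ?_, ?_, ?_⟩
  · intro z hz
    refine (Complex.hasSum_taylorSeries_on_ball hdiff hz).congr_fun fun n => ?_
    rw [sub_zero, smul_comm]
  · intro n
    refine (norm_taylorCoeff_le hdiff (fun z hz => ?_) n).trans (le_max_left _ _)
    exact (norm_sub_le _ _).trans (add_le_add_left (hL z hz) _)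
  · intro n
    refine (norm_taylorCoeff_add_two_le hdiff (fun z hz => ?_) n).trans (le_max_right _ _)
    have hz1 : ‖z‖ < 1 := mem_ball_zero_iff.1 hz
    have he : deriv (fun z => p.eval z • T z - 1) =ᶠ[nhds z]
        fun z => p.derivative.eval z • T z - (p.eval z * p.derivative.eval z) • (T z * T z) := by
      filter_upwards [isOpen_ball.mem_nhds hz] with w hw using (hK1 w hw).deriv
    rw [he.deriv_eq, (hK2 z hz).deriv]
    refine norm_second_deriv_aux _ _ _ _ hc ?_ ?_ (hp z hz1.le) (hL z hz)
      ((hp1 z hz1.le).trans (le_max_left _ _)) ((hp2 z hz1.le).trans (le_max_right _ _))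
    · rw [norm_pos_iff, sub_ne_zero]
      rintro rfl
      simp at hz1
    · refine (norm_sub_le _ _).trans ?_
      rw [norm_one]
      linarith

theorem sum_norm_le_log {F : Type*} [NormedAddCommGroup F] {B : ℝ} {E : ℕ → F}
    (h1 : ∀ n, ‖E n‖ ≤ B) (h2 : ∀ n : ℕ, (n + 1) * ‖E (n + 2)‖ ≤ B) {N : ℕ} (hN : 2 ≤ N) :
    ∑ n ∈ Finset.range N, ‖E n‖ ≤ 7 * B * Real.log N := by
  obtain ⟨m, rfl⟩ := Nat.exists_eq_add_of_le' hN
  have hB : 0 ≤ B := (norm_nonneg _).trans (h1 0)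
  have hlog2 : Real.log 2 ≤ Real.log (m + 2 : ℕ) :=
    Real.log_le_log (by norm_num) (by push_cast; linarith [(Nat.cast_nonneg m : (0 : ℝ) ≤ m)])
  have hharm : ∑ n ∈ Finset.range m, ((n : ℝ) + 1)⁻¹ ≤ 1 + Real.log (m + 2 : ℕ) := by
    rcases Nat.eq_zero_or_pos m with rfl | hm
    · simp only [Finset.range_zero, Finset.sum_empty]
      linarith [Real.log_two_gt_d9]
    · have h := harmonic_le_one_add_log m
      rw [harmonic] at h
      push_cast at h
      refine h.trans (add_le_add_right (Real.log_le_log (by exact_mod_cast hm) ?_) _)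
      push_cast
      linarith
  have hsum : ∑ n ∈ Finset.range m, ‖E (n + 2)‖
      ≤ B * ∑ n ∈ Finset.range m, ((n : ℝ) + 1)⁻¹ := by
    rw [Finset.mul_sum]
    refine Finset.sum_le_sum fun n _ => ?_
    rw [← div_eq_mul_inv, le_div_iff₀ (by positivity), mul_comm]
    exact h2 n
  -- The two leading terms and the harmonic sum give `3B + B log N`; as `log N ≥ 1/2`, this is at
  -- most `7B log N`.
  rw [Finset.sum_range_succ', Finset.sum_range_succ']
  have h3 := mul_le_mul_of_nonneg_left hharm hB
  have h4 := mul_le_mul_of_nonneg_left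
    (show (1 : ℝ) / 2 ≤ Real.log (m + 2 : ℕ) by linarith [Real.log_two_gt_d9]) hB
  have h5 := h1 0
  have h6 := h1 1
  simp only [zero_add] at *
  linarith

end Kernel

/-! ### Calculus of power series on the unit disc. -/

section Coefficients

variable {F : Type*} [NormedAddCommGroup F] [NormedSpace ℂ F]

/-- `G` is the sum of the power series with coefficients `a` in the open unit disc. -/
def HasDiscSeries (G : ℂ → F) (a : ℕ → F) : Prop :=
  ∀ z ∈ ball (0 : ℂ) 1, HasSum (fun n => z ^ n • a n) (G z)

/-- The formal power series with the given coefficients. -/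
noncomputable def powerSeriesOf (a : ℕ → F) : FormalMultilinearSeries ℂ ℂ F :=
  fun n => ContinuousMultilinearMap.mkPiRing ℂ (Fin n) (a n)

theorem coeff_powerSeriesOf (a : ℕ → F) (n : ℕ) : (powerSeriesOf a).coeff n = a n := by
  simp [FormalMultilinearSeries.coeff, powerSeriesOf]

namespace HasDiscSeries

theorem congr {G H : ℂ → F} {a : ℕ → F} (h : HasDiscSeries G a)
    (e : ∀ z ∈ ball (0 : ℂ) 1, H z = G z) : HasDiscSeries H a :=
  fun z hz => (e z hz).symm ▸ h z hz

theorem sum {ι : Type*} {G : ι → ℂ → F} {a : ι → ℕ → F} (s : Finset ι)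
    (h : ∀ i ∈ s, HasDiscSeries (G i) (a i)) :
    HasDiscSeries (fun z => ∑ i ∈ s, G i z) (fun n => ∑ i ∈ s, a i n) := fun z hz => by
  simpa only [Finset.smul_sum] using hasSum_sum fun i hi => h i hi z hz

theorem const_smul {G : ℂ → F} {a : ℕ → F} (h : HasDiscSeries G a) (c : ℂ) :
    HasDiscSeries (fun z => c • G z) (fun n => c • a n) := fun z hz => by
  simpa only [smul_comm c] using (h z hz).const_smul c

theorem sub {G H : ℂ → F} {a b : ℕ → F} (hG : HasDiscSeries G a) (hH : HasDiscSeries H b) :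
    HasDiscSeries (fun z => G z - H z) (fun n => a n - b n) := fun z hz => by
  simpa only [smul_sub] using (hG z hz).sub (hH z hz)

theorem map {F' : Type*} [NormedAddCommGroup F'] [NormedSpace ℂ F'] (φ : F →L[ℂ] F')
    {G : ℂ → F} {a : ℕ → F} (h : HasDiscSeries G a) :
    HasDiscSeries (fun z => φ (G z)) (fun n => φ (a n)) := fun z hz => by
  simpa only [map_smul] using φ.hasSum (h z hz)

theorem shift {G : ℂ → F} {a : ℕ → F} (h : HasDiscSeries G a) (j : ℕ) :
    HasDiscSeries (fun z => z ^ j • G z) (fun n => if j ≤ n then a (n - j) else 0) :=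
  fun z hz => by
  have h0 : ∀ n ∉ Set.range (fun n : ℕ => n + j),
      z ^ n • (if j ≤ n then a (n - j) else 0) = 0 := by
    intro n hn
    rw [if_neg, smul_zero]
    exact fun hj => hn ⟨n - j, Nat.sub_add_cancel hj⟩
  rw [← Function.Injective.hasSum_iff (add_left_injective j) h0]
  refine ((h z hz).const_smul (z ^ j)).congr_fun fun n => ?_
  simp [pow_add, smul_smul, mul_comm]

theorem polynomial {a : ℕ → F} {N : ℕ} (h : ∀ n, N ≤ n → a n = 0) :
    HasDiscSeries (fun z => ∑ n ∈ Finset.range N, z ^ n • a n) a := fun z _ =>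
  hasSum_sum_of_ne_finset_zero fun n hn => by
    rw [h n (by simpa using hn), smul_zero]

theorem hasFPowerSeriesAt {G : ℂ → F} {a : ℕ → F} (h : HasDiscSeries G a) :
    HasFPowerSeriesAt G (powerSeriesOf a) 0 := by
  refine hasFPowerSeriesAt_iff.2 ?_
  filter_upwards [ball_mem_nhds (0 : ℂ) one_pos] with z hz
  simpa only [coeff_powerSeriesOf, zero_add] using h z hz

theorem unique {G : ℂ → F} {a b : ℕ → F} (ha : HasDiscSeries G a) (hb : HasDiscSeries G b) :
    a = b := by
  have e := ha.hasFPowerSeriesAt.eq_formalMultilinearSeries hb.hasFPowerSeriesAt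
  ext n
  rw [← coeff_powerSeriesOf a n, e, coeff_powerSeriesOf]

end HasDiscSeries

variable {X : Type*} [NormedAddCommGroup X] [NormedSpace ℂ X]

/-- Coefficients of the product of an operator-valued power series and a polynomial. -/
theorem coeff_eq_convolution {K : ℂ → X →L[ℂ] X} {E : ℕ → X →L[ℂ] X} (hK : HasDiscSeries K E)
    {G H : ℂ → X} {a b : ℕ → X} (hG : HasDiscSeries G a) {m : ℕ} (ha : ∀ n, m ≤ n → a n = 0)
    (hH : HasDiscSeries H b) (e : ∀ z ∈ ball (0 : ℂ) 1, H z = K z (G z)) (n : ℕ) :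
    b n = ∑ j ∈ Finset.range m, if j ≤ n then E (n - j) (a j) else 0 := by
  have h : HasDiscSeries H
      (fun n => ∑ j ∈ Finset.range m, if j ≤ n then E (n - j) (a j) else 0) := by
    refine (HasDiscSeries.sum (Finset.range m) fun j _ =>
      (hK.map (ContinuousLinearMap.apply ℂ X (a j))).shift j).congr fun z hz => ?_
    rw [e z hz, (hG z hz).unique (HasDiscSeries.polynomial ha z hz), map_sum]
    simp
  exact congrFun (hH.unique h) n

end Coefficients

/-! ### Sequence norms and Young's inequality. -/

section SequenceNorm

variable {X : Type*} [NormedAddCommGroup X]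

theorem seqNorm_nonneg {p : ENNReal} (hp : 1 ≤ p) (N : ℕ) (v : ℕ → X) : 0 ≤ seqNorm p N v := by
  have : Fact (1 ≤ p) := ⟨hp⟩
  exact norm_nonneg _

theorem seqNorm_mono {Y : Type*} [NormedAddCommGroup Y] {p : ENNReal} (hp : 1 ≤ p) {N : ℕ}
    {v : ℕ → X} {w : ℕ → Y} (h : ∀ n, 1 ≤ n → n ≤ N → ‖v n‖ ≤ ‖w n‖) :
    seqNorm p N v ≤ seqNorm p N w := by
  have h' : ∀ i : Fin N, ‖v (i + 1)‖ ≤ ‖w (i + 1)‖ := fun i => h _ (by omega) (by omega)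
  rcases eq_or_ne p ⊤ with rfl | hpt
  · rw [seqNorm, seqNorm, PiLp.norm_eq_ciSup, PiLp.norm_eq_ciSup]
    exact ciSup_mono (Set.finite_range _).bddAbove h'
  · have h0 : 0 < p.toReal := ENNReal.toReal_pos (one_pos.trans_le hp).ne' hpt
    rw [seqNorm, seqNorm, PiLp.norm_eq_sum h0, PiLp.norm_eq_sum h0]
    gcongr with i
    exact h' i

/-- The shift only drops final entries and pads with zeros. The strict `m < n` matters: `f 0` does
not enter the norm. -/
theorem seqNorm_shift_le {p : ENNReal} (hp : 1 ≤ p) (N m : ℕ) (f : ℕ → X) :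
    seqNorm p N (fun n => if m < n then f (n - m) else 0) ≤ seqNorm p N f := by
  rcases eq_or_ne p ⊤ with rfl | hpt
  · rw [seqNorm, seqNorm, PiLp.norm_eq_ciSup, PiLp.norm_eq_ciSup]
    have hb : BddAbove (Set.range fun i : Fin N => ‖f (i + 1)‖) := (Set.finite_range _).bddAbove
    refine Real.iSup_le (fun i => ?_) (Real.iSup_nonneg fun i => norm_nonneg _)
    simp only
    split_ifs with h
    · have hi := i.2
      refine le_trans (le_of_eq ?_) (le_ciSup hb ⟨i - m, by omega⟩)
      simp only
      congr 2
      omega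
    · rw [norm_zero]
      exact Real.iSup_nonneg fun i => norm_nonneg _
  · have h0 : 0 < p.toReal := ENNReal.toReal_pos (one_pos.trans_le hp).ne' hpt
    rw [seqNorm, seqNorm, PiLp.norm_eq_sum h0, PiLp.norm_eq_sum h0]
    refine Real.rpow_le_rpow (Finset.sum_nonneg fun i _ => by positivity) ?_ (by positivity)
    simp only
    rw [Fin.sum_univ_eq_sum_range (fun i => ‖if m < i + 1 then f (i + 1 - m) else 0‖ ^ p.toReal),
      Fin.sum_univ_eq_sum_range (fun i => ‖f (i + 1)‖ ^ p.toReal)]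
    calc ∑ i ∈ Finset.range N, ‖if m < i + 1 then f (i + 1 - m) else 0‖ ^ p.toReal
        = ∑ i ∈ Finset.Ico m N, ‖f (i + 1 - m)‖ ^ p.toReal := by
          symm
          refine Finset.sum_subset_zero_on_sdiff (fun i hi => ?_) (fun i hi => ?_)
            (fun i hi => ?_)
          · exact Finset.mem_range.2 (Finset.mem_Ico.1 hi).2
          · rw [Finset.mem_sdiff, Finset.mem_range, Finset.mem_Ico] at hi
            rw [if_neg (by omega), norm_zero, Real.zero_rpow h0.ne']
          · rw [Finset.mem_Ico] at hi
            rw [if_pos (by omega)]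
      _ = ∑ i ∈ Finset.range (N - m), ‖f (i + 1)‖ ^ p.toReal := by
          rw [Finset.sum_Ico_eq_sum_range]
          refine Finset.sum_congr rfl fun i _ => ?_
          rw [show m + i + 1 - m = i + 1 by omega]
      _ ≤ _ := Finset.sum_le_sum_of_subset_of_nonneg
          (Finset.range_subset_range.2 (Nat.sub_le _ _)) fun i _ _ => by positivity

theorem seqNorm_sum_le {p : ENNReal} (hp : 1 ≤ p) (N : ℕ) {ι : Type*} (s : Finset ι)
    (g : ι → ℕ → X) :
    seqNorm p N (fun n => ∑ i ∈ s, g i n) ≤ ∑ i ∈ s, seqNorm p N (g i) := by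
  have : Fact (1 ≤ p) := ⟨hp⟩
  have e : (WithLp.toLp p (fun j : Fin N => ∑ i ∈ s, g i (j + 1)) : PiLp p (fun _ : Fin N => X))
      = ∑ i ∈ s, WithLp.toLp p (fun j : Fin N => g i (j + 1)) := by
    ext j
    simp
  rw [seqNorm, e]
  exact norm_sum_le _ _

variable [NormedSpace ℂ X]

theorem seqNorm_clm_le {p : ENNReal} (hp : 1 ≤ p) (N : ℕ) (T : X →L[ℂ] X) (f : ℕ → X) :
    seqNorm p N (fun n => T (f n)) ≤ ‖T‖ * seqNorm p N f := by
  have : Fact (1 ≤ p) := ⟨hp⟩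
  have h : seqNorm p N (fun n => T (f n)) ≤ seqNorm p N (fun n => (‖T‖ : ℂ) • f n) :=
    seqNorm_mono hp fun n _ _ => by
      rw [norm_smul, Complex.norm_real, norm_norm]
      exact T.le_opNorm _
  refine h.trans_eq ?_
  have e : (WithLp.toLp p (fun i : Fin N => (‖T‖ : ℂ) • f (i + 1)) : PiLp p (fun _ : Fin N => X))
      = (‖T‖ : ℂ) • WithLp.toLp p (fun i : Fin N => f (i + 1)) := rfl
  rw [seqNorm, seqNorm, e, norm_smul, Complex.norm_real, norm_norm]

/-- Young's inequality for a finite operator-valued convolution. -/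
theorem seqNorm_convolution_le {p : ENNReal} (hp : 1 ≤ p) (N : ℕ) (E : ℕ → X →L[ℂ] X)
    (f : ℕ → X) :
    seqNorm p N (fun n => ∑ m ∈ Finset.range N, E m (if m < n then f (n - m) else 0))
      ≤ (∑ m ∈ Finset.range N, ‖E m‖) * seqNorm p N f := by
  refine (seqNorm_sum_le hp N _ _).trans ?_
  rw [Finset.sum_mul]
  exact Finset.sum_le_sum fun m _ => (seqNorm_clm_le hp N _ _).trans
    (mul_le_mul_of_nonneg_left (seqNorm_shift_le hp N m f) (norm_nonneg _))

end SequenceNorm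

/-! ### Resolvent identity and resolvent bound. -/

section Resolvent

variable {X : Type*} [NormedAddCommGroup X] [NormedSpace ℂ X] {A : X →ₗ.[ℂ] X}

theorem Resolvent.sub_eq {z w : ℂ} (R : Resolvent A z) (S : Resolvent A w) :
    R.toCLM - S.toCLM = (w - z) • (R.toCLM * S.toCLM) := by
  ext y
  have h1 := R.left_inv ⟨S.toCLM y, S.mem_domain y⟩
  have h2 := S.right_inv y
  have h3 : z • S.toCLM y - A ⟨S.toCLM y, S.mem_domain y⟩ = y - (w - z) • S.toCLM y := by
    have h4 : y - w • S.toCLM y = -A ⟨S.toCLM y, S.mem_domain y⟩ := by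
      rw [sub_eq_iff_eq_add, ← sub_eq_neg_add]
      exact h2.symm
    rw [sub_smul, sub_sub_eq_add_sub, add_sub_right_comm, h4]
    abel
  simp only [h3, map_sub, map_smul] at h1
  simp only [sub_apply, smul_apply]
  rw [← h1]
  simp

theorem Resolvent.norm_smul_le {z : ℂ} (R : Resolvent A z) {M : ℝ}
    (hM : ∀ y : X, ‖A ⟨R.toCLM y, R.mem_domain y⟩‖ ≤ M * ‖y‖) :
    ‖z • R.toCLM‖ ≤ 1 + |M| := by
  refine ContinuousLinearMap.opNorm_le_bound _ (by positivity) fun y => ?_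
  have h : z • R.toCLM y = y + A ⟨R.toCLM y, R.mem_domain y⟩ := sub_eq_iff_eq_add.1 (R.right_inv y)
  rw [smul_apply, h, add_mul, one_mul]
  exact (norm_add_le _ _).trans (add_le_add_right ((hM y).trans
    (mul_le_mul_of_nonneg_right (le_abs_self M) (norm_nonneg _))) _)

end Resolvent

/-! ### Discrete variation of constants and the final estimate. -/

variable {X : Type*} [NormedAddCommGroup X] [NormedSpace ℂ X] {A : X →ₗ.[ℂ] X}

/-- Discrete variation of constants: `A u_n` is the convolution of the inhomogeneity with the
Taylor coefficients of `δ T - 1`, where `T` is the resolvent along `δ`. -/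
theorem IsNumericalSolution.apply_eq_convolution {k : ℕ} (hk : 1 ≤ k) {τ : ℝ} (hτ : 0 < τ)
    {N : ℕ} {f : ℕ → X} {u : ℕ → A.domain} (hu : IsNumericalSolution A k τ N f u)
    {T : ℂ → X →L[ℂ] X} {E : ℕ → X →L[ℂ] X}
    (hT : ∀ z ∈ ball (0 : ℂ) 1, ∀ x : A.domain,
      T z ((genPoly k).eval z • (x : X) - (τ : ℂ) • A x) = x)
    (hE : HasDiscSeries (fun z => (genPoly k).eval z • T z - 1) E) {n : ℕ} (hn : n ≤ N) :
    A (u n) = ∑ m ∈ Finset.range N,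
      E m (if m < n then (if k ≤ n - m then f (n - m) else 0) else 0) := by
  have hτ0 : (τ : ℂ) ≠ 0 := by exact_mod_cast hτ.ne'
  -- The scheme is not imposed for `n < k`, where the zero starting values correspond to zero data.
  set g : ℕ → X := fun n => if k ≤ n then f n else 0 with hg
  -- Truncation makes the generating function a polynomial, so `A` passes through a finite sum by
  -- linearity alone. The spurious data it creates at indices above `N` cannot affect coefficients
  -- `n ≤ N`.
  set v : ℕ → A.domain := fun n => if n ≤ N then u n else 0 with hv
  have hv0 : ∀ m, N + 1 ≤ m → v m = 0 := fun m hm => if_neg (by omega)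
  have hvu : ∀ m, m ≤ N → v m = u m := fun m hm => if_pos hm
  have hA0 : A 0 = 0 := A.map_zero
  set U : ℂ → A.domain := fun z => ∑ m ∈ Finset.range (N + 1), z ^ m • v m with hU
  have hV : HasDiscSeries (fun z => (U z : X)) (fun m => (v m : X)) :=
    (HasDiscSeries.polynomial (N := N + 1) fun m hm => by rw [hv0 m hm]; rfl).congr
      fun z _ => by simp [hU]
  have hAV : HasDiscSeries (fun z => A (U z)) (fun m => A (v m)) :=
    (HasDiscSeries.polynomial (N := N + 1) fun m hm => by rw [hv0 m hm, hA0]).congr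
      fun z _ => by
        simp only [hU, ← LinearPMap.toFun_eq_coe, map_sum, map_smul]
  set a : ℕ → X := fun n => (∑ j ∈ Finset.range (k + 1),
    (genPoly k).coeff j • (if j ≤ n then (v (n - j) : X) else 0)) - (τ : ℂ) • A (v n) with ha
  have hG : HasDiscSeries (fun z => (genPoly k).eval z • (U z : X) - (τ : ℂ) • A (U z)) a :=
    ((HasDiscSeries.sum (Finset.range (k + 1)) fun j _ =>
      (hV.shift j).const_smul ((genPoly k).coeff j)).sub (hAV.const_smul (τ : ℂ))).congr
        fun z _ => by
          rw [genPoly_eval_eq_sum, Finset.sum_smul]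
          simp only [mul_smul]
  have ha0 : ∀ m, N + k + 1 ≤ m → a m = 0 := by
    intro m hm
    simp only [ha]
    rw [hv0 m (by omega), hA0, smul_zero, sub_zero]
    refine Finset.sum_eq_zero fun j hj => ?_
    have := Finset.mem_range.1 hj
    rw [hv0 (m - j) (by omega)]
    simp
  have hag : ∀ m, m ≤ N → a m = (τ : ℂ) • g m := by
    intro m hm
    simp only [ha, hg]
    rcases lt_or_ge m k with h | h
    · rw [if_neg (by omega), hvu m hm, hu.1 m h, hA0, smul_zero, sub_zero]
      refine Finset.sum_eq_zero fun j hj => ?_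
      rw [hvu (m - j) (by omega), hu.1 (m - j) (by omega)]
      simp
    · have h1 := hu.2 m h hm
      rw [one_div, inv_smul_eq_iff₀ hτ0] at h1
      rw [if_pos h, hvu m hm, sub_eq_iff_eq_add, ← smul_add, add_comm (f m), ← h1, diffSum]
      refine Finset.sum_congr rfl fun j hj => ?_
      have := Finset.mem_range.1 hj
      rw [if_pos (by omega), hvu (m - j) (by omega)]
  -- `T` inverts `δ - τA` from the left, so `(δT - 1)(δU - τAU) = δU - (δU - τAU) = τAU`.
  have key := coeff_eq_convolution hE hG ha0 (hAV.const_smul (τ : ℂ)) (fun z hz => by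
    have := hT z hz (U z)
    simp only [sub_apply, smul_apply, one_apply_eq_self, this]
    abel) n
  have hconv : ∑ j ∈ Finset.range (N + k + 1), (if j ≤ n then E (n - j) (a j) else 0)
      = (τ : ℂ) • ∑ m ∈ Finset.range N, E m (if m < n then g (n - m) else 0) := by
    have h1 : ∑ j ∈ Finset.range (N + k + 1), (if j ≤ n then E (n - j) (a j) else 0)
        = ∑ j ∈ Finset.range (n + 1), (τ : ℂ) • E (n - j) (g j) := by
      symm
      refine Finset.sum_subset_zero_on_sdiff ?_ (fun j hj => ?_) (fun j hj => ?_)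
      · exact Finset.range_subset_range.2 (by omega)
      · rw [Finset.mem_sdiff, Finset.mem_range, Finset.mem_range] at hj
        rw [if_neg (by omega)]
      · have := Finset.mem_range.1 hj
        rw [if_pos (by omega), hag j (by omega), map_smul]
    rw [h1, ← Finset.smul_sum, ← Finset.sum_flip (fun m => E (n - m) (g m)),
      Finset.sum_range_succ]
    -- The term with `m = n` involves `g 0`, which vanishes because `k ≥ 1`.
    have hg0 : g (n - n) = 0 := by rw [Nat.sub_self]; exact if_neg (by omega)
    rw [hg0, map_zero, add_zero]
    congr 1
    refine Finset.sum_subset_zero_on_sdiff (Finset.range_subset_range.2 hn) (fun j hj => ?_)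
      (fun j hj => ?_)
    · rw [Finset.mem_sdiff, Finset.mem_range, Finset.mem_range] at hj
      rw [if_neg (by omega), map_zero]
    · have := Finset.mem_range.1 hj
      rw [if_pos this, show n - (n - j) = j by omega]
  rw [hconv, hvu n hn] at key
  exact smul_right_injective X hτ0 key

end BDF

theorem mainTheorem10 {X : Type*} [NormedAddCommGroup X] [NormedSpace ℂ X] [CompleteSpace X]
    (A : X →ₗ.[ℂ] X) (k : ℕ) (hk1 : 1 ≤ k) (hk6 : k ≤ 6)
    (ϑ : ℝ) (hϑ : Real.pi - BDF.stabilityAngle k < ϑ)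
    (hA : BDF.BoundedOnSector A ϑ) :
    ∃ C : ℝ, ∀ (τ : ℝ), 0 < τ → ∀ (N : ℕ), 2 ≤ N → ∀ (p : ENNReal), 1 ≤ p →
      ∀ (f : ℕ → X) (u : ℕ → A.domain), BDF.IsNumericalSolution A k τ N f u →
        BDF.seqNorm p N (fun n => A (u n)) ≤ C * Real.log N * BDF.seqNorm p N f := by
  obtain ⟨M, hM⟩ := hA
  choose R hR using hM
  obtain ⟨c, hc, hδ⟩ := BDF.exists_le_norm_genPoly_eval hk1 hk6
  obtain ⟨B, hB⟩ := BDF.exists_kernel_bound (X →L[ℂ] X) (BDF.genPoly k) (L := 1 + |M|) hc hδ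
  refine ⟨7 * B, fun τ hτ N hN p hp f u hu => ?_⟩
  have hτ0 : (τ : ℂ) ≠ 0 := by exact_mod_cast hτ.ne'
  have hmem : ∀ z ∈ Metric.ball (0 : ℂ) 1,
      ((τ⁻¹ : ℝ) : ℂ) * (BDF.genPoly k).eval z ∈ BDF.sector ϑ := fun z hz =>
    BDF.sector_smul (BDF.genPoly_eval_mem_sector hk1 hk6 hϑ (mem_ball_zero_iff.1 hz))
      (inv_pos.2 hτ)
  classical
  -- This is `τ⁻¹(δ/τ - A)⁻¹ = (δ - τA)⁻¹`. Then `δT = (δ/τ)(δ/τ - A)⁻¹`, so the bound `1 + |M|` is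
  -- free of `τ`.
  set T : ℂ → X →L[ℂ] X := fun z =>
    if hz : z ∈ Metric.ball (0 : ℂ) 1 then ((τ⁻¹ : ℝ) : ℂ) • (R _ (hmem z hz)).toCLM else 0 with hTdef
  have hT : ∀ z (hz : z ∈ Metric.ball (0 : ℂ) 1), T z = ((τ⁻¹ : ℝ) : ℂ) • (R _ (hmem z hz)).toCLM :=
    fun z hz => dif_pos hz
  obtain ⟨E, hE, hE1, hE2⟩ := hB T (fun z hz w hw => by
      rw [hT z hz, hT w hw, ← smul_sub, BDF.Resolvent.sub_eq, smul_mul_smul_comm, smul_smul,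
        smul_smul]
      congr 1
      push_cast
      ring) (fun z hz => by
      have h := (R _ (hmem z hz)).norm_smul_le (hR _ (hmem z hz))
      rwa [hT z hz, smul_smul, mul_comm])
  have hleft : ∀ z ∈ Metric.ball (0 : ℂ) 1, ∀ x : A.domain,
      T z ((BDF.genPoly k).eval z • (x : X) - (τ : ℂ) • A x) = x := by
    intro z hz x
    rw [hT z hz, smul_apply, ← map_smul]
    refine Eq.trans ?_ ((R _ (hmem z hz)).left_inv x)
    congr 1
    rw [smul_sub, smul_smul, Complex.ofReal_inv, inv_smul_smul₀ hτ0]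
  have h1 : BDF.seqNorm p N (fun n => A (u n)) ≤ BDF.seqNorm p N (fun n =>
      ∑ m ∈ Finset.range N, E m (if m < n then (if k ≤ n - m then f (n - m) else 0) else 0)) :=
    BDF.seqNorm_mono hp fun n _ hn => by rw [hu.apply_eq_convolution hk1 hτ hleft hE hn]
  refine h1.trans ((BDF.seqNorm_convolution_le hp N E (fun n => if k ≤ n then f n else 0)).trans ?_)
  refine mul_le_mul (BDF.sum_norm_le_log hE1 hE2 hN) (BDF.seqNorm_mono hp fun n _ _ => ?_)
    (BDF.seqNorm_nonneg hp _ _) ((Finset.sum_nonneg fun _ _ => norm_nonneg _).trans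
      (BDF.sum_norm_le_log hE1 hE2 hN))
  split_ifs
  · exact le_rfl
  · simp
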